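/- Let $\Lambda$ be an Artin algebra (an algebra that is finitely generated as a module over a commutative artinian ring), let $\mathrm{mod}\,\Lambda$ be the category of finitely generated left $\Lambda$-modules, and let $\mathcal{P}\subseteq\mathrm{mod}\,\Lambda$ be the class of projective modules. For $M\in\mathrm{mod}\,\Lambda$, the syzygy $\Omega M$ is the kernel of the projective cover of $M$, and $\Omega^n(\mathrm{mod}\,\Lambda)=\{\Omega^nM : M\in\mathrm{mod}\,\Lambda\}$. All dimensions below take values in $\mathbb{N}\cup\{\infty\}$, with $\min\emptyset=\infty$. Let $K$ be the abelian group generated by the symbols $[M]$, $M\in\mathrm{mod}\,\Lambda$, with the relations $[M]=[X]+[Y]$ whenever $M\cong X\oplus Y$. For a class $\mathcal{X}\subseteq\mathrm{mod}\,\Lambda$ let $\langle\mathcal{X}\rangle\subseteq K$ be the subgroup generated by the $[M]$ with $M$ indecomposable in $\mathcal{X}\cup\mathcal{P}$. Let $\overline{L}$ be the endomorphism of $K/\langle\mathcal{P}\rangle$ induced by $[M]\mapsto[\Omega M]$. The Igusa--Todorov function is $$\Phi(X)=\min\{k\in\mathbb{N} : \overline{L}\colon \overline{L}^{m}(\overline{\langle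 X\rangle})\to\overline{L}^{m+1}(\overline{\langle X\rangle})\text{ is an isomorphism for all } m\ge k\},$$ where $\overline{\langle X\rangle}$ is the image of $\langle\mathrm{add}\,X\rangle$ in $K/\langle\mathcal{P}\rangle$ and $\mathrm{add}\,X$ is the class of direct summands of finite direct sums of copies of $X$. For a class $\mathcal{X}$ put $\Phi\mathrm{dim}(\mathcal{X})=\sup_{X\in\mathcal{X}}\Phi(X)$, and put $\Phi\mathrm{dim}\,\Lambda=\Phi\mathrm{dim}(\mathrm{mod}\,\Lambda)$. For $M\in\mathrm{mod}\,\Lambda$ let $\mathrm{pd}\,M=\min\{n\in\mathbb{N}:\mathrm{Ext}^j_\Lambda(M,Y)=0\text{ for all } j>n,\ Y\in\mathrm{mod}\,\Lambda\}$, and let $\mathrm{fin.dim}\,\Lambda=\sup\{\mathrm{pd}\,M : M\in\mathrm{mod}\,\Lambda,\ \mathrm{pd}\,M<\infty\}$. For classes $\mathcal{X},\omega\subseteq\mathrm{mod}\,\Lambda$ let $\mathrm{id}_{\mathcal{X}}(\omega)=\sup_{W\in\omega}\min\{n\in\mathbb{N}:\mathrm{Ext}^j_\Lambda(X,W)=0\text{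 for all } j>n,\ X\in\mathcal{X}\}$, and let $\mathrm{id}(\omega)=\mathrm{id}_{\mathrm{mod}\,\Lambda}(\omega)$. The $\mathcal{X}$-resolution dimension $\mathrm{resdim}_{\mathcal{X}}(M)$ is the least $n\in\mathbb{N}$ for which there is an exact sequence $0\to X_n\to\cdots\to X_0\to M\to 0$ with all $X_i\in\mathcal{X}$; moreover $\mathrm{resdim}_{\mathcal{X}}(\mathcal{Y})=\sup_{Y\in\mathcal{Y}}\mathrm{resdim}_{\mathcal{X}}(Y)$ and $\mathcal{X}^{\wedge}=\{M\in\mathrm{mod}\,\Lambda:\mathrm{resdim}_{\mathcal{X}}(M)<\infty\}$. Let $n\ge 0$ be an integer and let $\mathcal{D}\subseteq\mathrm{mod}\,\Lambda$ be left saturated: closed under extensions, under kernels of epimorphisms between its objects and under direct summands, with $\mathcal{P}\subseteq\mathcal{D}$. Then: (a) $\mathrm{fin.dim}\,\Lambda\le\Phi\mathrm{dim}\,\Lambda\le\mathrm{resdim}_{\mathcal{D}}(\Omega^n(\mathrm{mod}\,\Lambda))+\Phi\mathrm{dim}(\mathcal{D})+n.$ (b) Let $\omega\subseteq\mathcal{D}$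 be a class closed under direct summands that is $\mathcal{D}$-injective (that is, $\mathrm{id}_{\mathcal{D}}(\omega)=0$) and a relative cogenerator in $\mathcal{D}$ (that is, for every $X\in\mathcal{D}$ there is an exact sequence $0\to X\to W\to X'\to 0$ with $W\in\omega$ and $X'\in\mathcal{D}$). If $\Omega^n(\mathrm{mod}\,\Lambda)\subseteq\mathcal{D}^{\wedge}$, then $$\mathrm{fin.dim}\,\Lambda\le\Phi\mathrm{dim}\,\Lambda\le\mathrm{id}(\omega)+\Phi\mathrm{dim}(\mathcal{D})+n.$$ -/

import Mathlib

open CategoryTheory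

universe w u

noncomputable section

namespace IgusaTodorov

variable {Λ : Type u} [Ring Λ]

/-! ### Short exact sequences, direct summands, classes of modules -/

/-- `0 → X → Y → Z → 0` is a short exact sequence. -/
def IsShortExact {X Y Z : FGModuleCat.{u} Λ} (f : X →ₗ[Λ] Y) (g : Y →ₗ[Λ] Z) : Prop :=
  Function.Injective f ∧ Function.Exact f g ∧ Function.Surjective g

/-- `M` is (isomorphic to) a direct summand of `N`. -/
def IsSummand (M N : FGModuleCat.{u} Λ) : Prop :=
  ∃ N' : FGModuleCat.{u} Λ, Nonempty (N ≃ₗ[Λ] M × N')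

/-- The class of finitely generated projective modules. -/
def projClass (Λ : Type u) [Ring Λ] : Set (FGModuleCat.{u} Λ) :=
  {P | Module.Projective Λ P}

/-- A class of modules which is closed under direct summands in `mod Λ`. -/
def ClosedUnderSummands (𝒳 : Set (FGModuleCat.{u} Λ)) : Prop :=
  ∀ ⦃M N : FGModuleCat.{u} Λ⦄, IsSummand M N → N ∈ 𝒳 → M ∈ 𝒳

/-- Left saturated classes: closed under extensions, kernels of epimorphisms between objects of
the class, and direct summands, and containing all finitely generated projective modules. -/
structure IsLeftSaturated (𝒟 : Set (FGModuleCat.{u} Λ)) : Prop where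
  extensions : ∀ ⦃X Y Z : FGModuleCat.{u} Λ⦄ (f : X →ₗ[Λ] Y) (g : Y →ₗ[Λ] Z),
    IsShortExact f g → X ∈ 𝒟 → Z ∈ 𝒟 → Y ∈ 𝒟
  kernels : ∀ ⦃X Y Z : FGModuleCat.{u} Λ⦄ (f : X →ₗ[Λ] Y) (g : Y →ₗ[Λ] Z),
    IsShortExact f g → Y ∈ 𝒟 → Z ∈ 𝒟 → X ∈ 𝒟
  projectives : projClass Λ ⊆ 𝒟
  summands : ClosedUnderSummands 𝒟

/-! ### Homological dimensions, with values in `ℕ∞` (the infimum of the empty set is `⊤`) -/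

/-- The projective dimension of `M` relative to the class `𝒳`. -/
def relPd (𝒳 : Set (FGModuleCat.{u} Λ)) (M : FGModuleCat.{u} Λ) : ℕ∞ :=
  ⨅ (n : ℕ) (_ : ∀ j : ℕ, n < j → ∀ X ∈ 𝒳, Subsingleton (Abelian.Ext.{u} M.obj X.obj j)), (n : ℕ∞)

/-- The injective dimension of `M` relative to the class `𝒳`. -/
def relId (𝒳 : Set (FGModuleCat.{u} Λ)) (M : FGModuleCat.{u} Λ) : ℕ∞ :=
  ⨅ (n : ℕ) (_ : ∀ j : ℕ, n < j → ∀ X ∈ 𝒳, Subsingleton (Abelian.Ext.{u} X.obj M.obj j)), (n : ℕ∞)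

/-- The projective dimension of `M` in `mod Λ`. -/
def pd (M : FGModuleCat.{u} Λ) : ℕ∞ := relPd Set.univ M

/-- The injective dimension of the class `𝒴` relative to the class `𝒳`. -/
def relIdClass (𝒳 𝒴 : Set (FGModuleCat.{u} Λ)) : ℕ∞ := ⨆ Y ∈ 𝒴, relId 𝒳 Y

/-- The injective dimension of a class of modules. -/
def idClass (𝒴 : Set (FGModuleCat.{u} Λ)) : ℕ∞ := relIdClass Set.univ 𝒴

/-- The finitistic dimension of `Λ`. -/
def finDim (Λ : Type u) [Ring Λ] : ℕ∞ :=
  ⨆ (M : FGModuleCat.{u} Λ) (_ : pd M < ⊤), pd M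

/-- The class `ω` is a `𝒳`-injective relative cogenerator in `𝒳`. -/
structure IsInjectiveRelativeCogenerator (𝒳 ω : Set (FGModuleCat.{u} Λ)) : Prop where
  injective : relIdClass 𝒳 ω = 0
  subset : ω ⊆ 𝒳
  cogenerator : ∀ X ∈ 𝒳, ∃ W ∈ ω, ∃ X' ∈ 𝒳, ∃ (f : X →ₗ[Λ] W) (g : W →ₗ[Λ] X'),
    IsShortExact f g

/-- There is an exact sequence `0 → X n → ⋯ → X 1 → X 0 → M → 0` with all `X i` in `𝒳`
(the sequence is continued by zero modules in degrees `> n`). -/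
def HasResolution (𝒳 : Set (FGModuleCat.{u} Λ)) (n : ℕ) (M : FGModuleCat.{u} Λ) : Prop :=
  ∃ (X : ℕ → FGModuleCat.{u} Λ) (d : ∀ i, X (i + 1) →ₗ[Λ] X i) (ε : X 0 →ₗ[Λ] M),
    (∀ i ≤ n, X i ∈ 𝒳) ∧ (∀ i, n < i → Subsingleton (X i)) ∧
    Function.Surjective ε ∧ Function.Exact (d 0) ε ∧ ∀ i, Function.Exact (d (i + 1)) (d i)

/-- The `𝒳`-resolution dimension of `M`. -/
def resdim (𝒳 : Set (FGModuleCat.{u} Λ)) (M : FGModuleCat.{u} Λ) : ℕ∞ :=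
  ⨅ (n : ℕ) (_ : HasResolution 𝒳 n M), (n : ℕ∞)

/-- The `𝒳`-resolution dimension of a class of modules. -/
def resdimClass (𝒳 𝒴 : Set (FGModuleCat.{u} Λ)) : ℕ∞ := ⨆ Y ∈ 𝒴, resdim 𝒳 Y

/-- The class `𝒳^∧` of modules of finite `𝒳`-resolution dimension. -/
def finResdim (𝒳 : Set (FGModuleCat.{u} Λ)) : Set (FGModuleCat.{u} Λ) := {M | resdim 𝒳 M < ⊤}

/-! ### Projective covers and syzygies -/

/-- `π : P → M` is a projective cover: `P` is projective and `π` is an epimorphism with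
superfluous kernel. -/
structure IsProjectiveCover {P M : Type u} [AddCommGroup P] [Module Λ P] [AddCommGroup M]
    [Module Λ M] (π : P →ₗ[Λ] M) : Prop where
  projective : Module.Projective Λ P
  surjective : Function.Surjective π
  superfluous : ∀ N : Submodule Λ P, N ⊔ LinearMap.ker π = ⊤ → N = ⊤

theorem exists_projectiveCover [IsArtinianRing Λ] (M : FGModuleCat.{u} Λ) :
    ∃ (P : FGModuleCat.{u} Λ) (π : P →ₗ[Λ] M), IsProjectiveCover π := by
  classical
  -- choose an epimorphism from a projective module of minimal length
  let S : Set ℕ∞ := {l | ∃ (P : FGModuleCat.{u} Λ) (π : P →ₗ[Λ] M), Module.Projective Λ P ∧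
    Function.Surjective π ∧ l = Module.length Λ P}
  have hS : S.Nonempty := by
    obtain ⟨n, f, hf⟩ := Module.Finite.exists_fin' Λ M
    exact ⟨_, FGModuleCat.of Λ (Fin n → Λ), f,
      inferInstanceAs (Module.Projective Λ (Fin n → Λ)), hf, rfl⟩
  obtain ⟨P, π, hP, hπ, hl⟩ : sInf S ∈ S := csInf_mem hS
  refine ⟨P, π, hP, hπ, fun N hN => ?_⟩
  have hsurj : Function.Surjective (π ∘ₗ N.subtype) := by
    intro m
    obtain ⟨p, rfl⟩ := hπ m
    obtain ⟨a, ha, b, hb, rfl⟩ := Submodule.mem_sup.1 (hN ▸ Submodule.mem_top : p ∈ N ⊔ _)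
    exact ⟨⟨a, ha⟩, by simp [LinearMap.mem_ker.1 hb]⟩
  obtain ⟨h, hh⟩ := Module.projective_lifting_property (π ∘ₗ N.subtype) π hsurj
  let e : Module.End Λ P := N.subtype ∘ₗ h
  have he : ∀ p, π (e p) = π p := fun p => LinearMap.congr_fun hh p
  have hek : ∀ k p, π ((e ^ k) p) = π p := by
    intro k
    induction k with
    | zero => simp
    | succ k ih => intro p; rw [pow_succ', Module.End.mul_apply, he, ih]
  obtain ⟨k, hk⟩ := (e.eventually_isCompl_ker_pow_range_pow.and
    (Filter.eventually_ge_atTop 1)).exists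
  obtain ⟨hc, hk1⟩ := hk
  let Q := LinearMap.range (e ^ k)
  have hQN : Q ≤ N := by
    rintro _ ⟨p, rfl⟩
    obtain ⟨j, rfl⟩ : ∃ j, k = j + 1 := ⟨k - 1, by omega⟩
    rw [pow_succ', Module.End.mul_apply]
    exact (h _).2
  have hQproj : Module.Projective Λ Q :=
    Module.Projective.of_split Q.subtype (Submodule.projectionOnto Q _ hc.symm) (by
      ext x; simp)
  have hQs : Function.Surjective (π ∘ₗ Q.subtype) := by
    intro m
    obtain ⟨p, rfl⟩ := hπ m
    exact ⟨⟨(e ^ k) p, p, rfl⟩, hek k p⟩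
  have hle : Module.length Λ P ≤ Module.length Λ Q := by
    rw [← hl]
    exact sInf_le ⟨FGModuleCat.of Λ Q, π ∘ₗ Q.subtype, hQproj, hQs, rfl⟩
  have hQtop : Q = ⊤ := by
    by_contra hne
    have hlt := Submodule.length_lt (R := Λ) (M := P) (N := Q) hne
    exact absurd hle (not_le.2 hlt)
  exact top_le_iff.1 (hQtop ▸ hQN)

section

variable {P M P' M' : Type u} [AddCommGroup P] [Module Λ P] [AddCommGroup M] [Module Λ M]
  [AddCommGroup P'] [Module Λ P'] [AddCommGroup M'] [Module Λ M']

/-- Kernels of projective covers of isomorphic modules are isomorphic. -/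
theorem IsProjectiveCover.ker_equiv {π : P →ₗ[Λ] M} {π' : P' →ₗ[Λ] M'}
    (h : IsProjectiveCover π) (h' : IsProjectiveCover π') (e : M ≃ₗ[Λ] M') :
    Nonempty (LinearMap.ker π ≃ₗ[Λ] LinearMap.ker π') := by
  have := h.projective
  have := h'.projective
  obtain ⟨f, hf⟩ := Module.projective_lifting_property π' (e.toLinearMap ∘ₗ π) h'.surjective
  have hf' : ∀ p, π' (f p) = e (π p) := fun p => LinearMap.congr_fun hf p
  have hfs : Function.Surjective f := by
    rw [← LinearMap.range_eq_top]
    refine h'.superfluous _ (top_le_iff.1 fun x _ => ?_)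
    obtain ⟨p, hp⟩ := h.surjective (e.symm (π' x))
    refine Submodule.mem_sup.2 ⟨f p, ⟨p, rfl⟩, x - f p, ?_, by abel⟩
    rw [LinearMap.mem_ker, map_sub, hf', hp, LinearEquiv.apply_symm_apply, sub_self]
  obtain ⟨g, hg⟩ := Module.projective_lifting_property f LinearMap.id hfs
  have hg' : ∀ p, f (g p) = p := fun p => LinearMap.congr_fun hg p
  have hgs : LinearMap.range g = ⊤ := by
    refine h.superfluous _ (top_le_iff.1 fun x _ => ?_)
    refine Submodule.mem_sup.2 ⟨g (f x), ⟨f x, rfl⟩, x - g (f x), ?_, by abel⟩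
    have : e (π (x - g (f x))) = 0 := by
      rw [← hf', map_sub f, hg', sub_self, map_zero]
    exact LinearMap.mem_ker.2 ((LinearEquiv.map_eq_zero_iff e).1 this)
  have hfi : Function.Injective f := by
    intro x y hxy
    obtain ⟨a, rfl⟩ := LinearMap.range_eq_top.1 hgs x
    obtain ⟨b, rfl⟩ := LinearMap.range_eq_top.1 hgs y
    rw [hg', hg'] at hxy
    rw [hxy]
  let F : P ≃ₗ[Λ] P' := LinearEquiv.ofBijective f ⟨hfi, hfs⟩
  refine ⟨F.ofSubmodules _ _ ?_⟩
  ext x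
  constructor
  · rintro ⟨p, hp, rfl⟩
    change π' (f p) = 0
    rw [hf', LinearMap.mem_ker.1 hp, map_zero]
  · intro hx
    obtain ⟨p, rfl⟩ := hfs x
    refine ⟨p, ?_, rfl⟩
    have : e (π p) = 0 := by rw [← hf']; exact hx
    simpa using this

/-- A direct sum of two projective covers is a projective cover. -/
theorem IsProjectiveCover.prodMap {π : P →ₗ[Λ] M} {π' : P' →ₗ[Λ] M'}
    (h : IsProjectiveCover π) (h' : IsProjectiveCover π') :
    IsProjectiveCover (π.prodMap π') := by
  have := h.projective
  have := h'.projective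
  refine ⟨inferInstance, Function.Surjective.prodMap h.surjective h'.surjective,
    fun N hN => ?_⟩
  have key : ∀ p p', ∃ a b, (a, b) ∈ N ∧ π a = π p ∧ π' b = π' p' := by
    intro p p'
    obtain ⟨⟨a, b⟩, hab, ⟨c, d⟩, hcd, hs⟩ :=
      Submodule.mem_sup.1 (hN ▸ Submodule.mem_top : (p, p') ∈ N ⊔ _)
    obtain ⟨rfl, rfl⟩ := Prod.mk.inj hs
    obtain ⟨hc, hd⟩ := Prod.mk.inj (LinearMap.mem_ker.1 hcd)
    exact ⟨a, b, hab, by simp [show π c = 0 from hc], by simp [show π' d = 0 from hd]⟩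
  -- the elements `b` with `(a, b) ∈ N` for some `a ∈ ker π` form all of `P'`
  have h1 : (N ⊓ Submodule.comap (LinearMap.fst Λ P P') (LinearMap.ker π)).map
      (LinearMap.snd Λ P P') = ⊤ := by
    refine h'.superfluous _ (top_le_iff.1 fun x _ => ?_)
    obtain ⟨a, b, hab, ha, hb⟩ := key 0 x
    refine Submodule.mem_sup.2 ⟨b, ⟨(a, b), ⟨hab, ?_⟩, rfl⟩, x - b, ?_, by abel⟩
    · change π a = 0
      rw [ha, map_zero]
    · rw [LinearMap.mem_ker, map_sub, hb, sub_self]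
  -- hence so do the elements `a` with `(a, 0) ∈ N` in `P`
  have h2 : N.comap (LinearMap.inl Λ P P') = ⊤ := by
    refine h.superfluous _ (top_le_iff.1 fun x _ => ?_)
    obtain ⟨a, b, hab, ha, -⟩ := key x 0
    obtain ⟨⟨a', b'⟩, ⟨hN', ha'⟩, hb'⟩ :=
      (h1 ▸ Submodule.mem_top : b ∈ Submodule.map (LinearMap.snd Λ P P') _)
    have hb'' : b' = b := hb'
    subst hb''
    have ha'' : π a' = 0 := ha'
    refine Submodule.mem_sup.2 ⟨a - a', ?_, x - (a - a'), ?_, by abel⟩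
    · change (a - a', (0 : P')) ∈ N
      simpa using N.sub_mem hab hN'
    · rw [LinearMap.mem_ker, map_sub, map_sub, ha, ha'', sub_zero, sub_self]
  refine top_le_iff.1 fun x _ => ?_
  obtain ⟨x, y⟩ := x
  obtain ⟨⟨a', b'⟩, ⟨hN', -⟩, hb'⟩ :=
    (h1 ▸ Submodule.mem_top : y ∈ Submodule.map (LinearMap.snd Λ P P') _)
  have hb'' : b' = y := hb'
  subst hb''
  have hx : (x - a', (0 : P')) ∈ N :=
    (h2 ▸ Submodule.mem_top : x - a' ∈ N.comap (LinearMap.inl Λ P P'))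
  simpa using N.add_mem hx hN'

/-- The kernel of a direct sum of two maps is the direct sum of the kernels. -/
def kerProdMapEquiv (π : P →ₗ[Λ] M) (π' : P' →ₗ[Λ] M') :
    LinearMap.ker (π.prodMap π') ≃ₗ[Λ] LinearMap.ker π × LinearMap.ker π' where
  toFun x := (⟨x.1.1, (Prod.mk.inj x.2).1⟩, ⟨x.1.2, (Prod.mk.inj x.2).2⟩)
  invFun y := ⟨(y.1.1, y.2.1), Prod.ext y.1.2 y.2.2⟩
  map_add' _ _ := rfl
  map_smul' _ _ := rfl
  left_inv _ := rfl
  right_inv _ := rfl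

end

/-! ### The group `K` -/

/-- An indecomposable module is a nonzero module without nontrivial direct sum decompositions. -/
def IsIndecomposable (M : FGModuleCat.{u} Λ) : Prop :=
  Nontrivial M ∧ ∀ X Y : FGModuleCat.{u} Λ, Nonempty (M ≃ₗ[Λ] X × Y) →
    Subsingleton X ∨ Subsingleton Y

/-- The class `add X` of all direct summands of the finite direct sums `X^s`. -/
def addClass (X : FGModuleCat.{u} Λ) : Set (FGModuleCat.{u} Λ) :=
  {M | ∃ s : ℕ, IsSummand M (FGModuleCat.of Λ (Fin s → X))}

/-- The relations `[M] - [X] - [Y]` for `M ≃ X ⊕ Y`. (The cases `Y = 0` identify the symbols of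
isomorphic modules.) -/
def directSumRelations (Λ : Type u) [Ring Λ] : AddSubgroup (FreeAbelianGroup (FGModuleCat.{u} Λ)) :=
  AddSubgroup.closure {z | ∃ M X Y : FGModuleCat.{u} Λ, Nonempty (M ≃ₗ[Λ] X × Y) ∧
    z = FreeAbelianGroup.of M - FreeAbelianGroup.of X - FreeAbelianGroup.of Y}

/-- The group `K`: the free abelian group on finitely generated modules modulo direct sums. -/
abbrev K (Λ : Type u) [Ring Λ] : Type (u + 1) :=
  FreeAbelianGroup (FGModuleCat.{u} Λ) ⧸ directSumRelations Λ

/-- The class `[M]` in `K`. -/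
def cls (M : FGModuleCat.{u} Λ) : K Λ := QuotientAddGroup.mk (FreeAbelianGroup.of M)

theorem cls_prod {M X Y : FGModuleCat.{u} Λ} (e : Nonempty (M ≃ₗ[Λ] X × Y)) :
    cls M = cls X + cls Y := by
  have h : FreeAbelianGroup.of M - FreeAbelianGroup.of X - FreeAbelianGroup.of Y ∈
      directSumRelations Λ := AddSubgroup.subset_closure ⟨M, X, Y, e, rfl⟩
  have h0 := (QuotientAddGroup.eq_zero_iff _).2 h
  rw [QuotientAddGroup.mk_sub, QuotientAddGroup.mk_sub, sub_sub, sub_eq_zero] at h0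
  exact h0

theorem cls_subsingleton {M : FGModuleCat.{u} Λ} (h : Subsingleton M) : cls M = 0 := by
  have e : Nonempty (M ≃ₗ[Λ] M × M) := ⟨
    { toFun := fun x => (x, x)
      invFun := fun y => y.1
      map_add' := fun _ _ => rfl
      map_smul' := fun _ _ => rfl
      left_inv := fun _ => rfl
      right_inv := fun _ => Subsingleton.elim _ _ }⟩
  simpa using cls_prod e

/-- The subgroup `⟨𝒳⟩` of `K` generated by the indecomposable modules in `𝒳 ∪ 𝒫`. -/
def spanClass (𝒳 : Set (FGModuleCat.{u} Λ)) : AddSubgroup (K Λ) :=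
  AddSubgroup.closure {z | ∃ M ∈ 𝒳 ∪ projClass Λ, IsIndecomposable M ∧ z = cls M}

/-- The quotient `K / ⟨𝒫⟩`. -/
abbrev KP (Λ : Type u) [Ring Λ] : Type (u + 1) := K Λ ⧸ spanClass (projClass Λ)

/-- The number `η_f(X)` of Fitting's Lemma: the least `k` such that `f : f^m(X) → f^(m+1)(X)` is an
isomorphism for all `m ≥ k` (and `⊤` if there is no such `k`). -/
def eta {G : Type*} [AddCommGroup G] (f : G →+ G) (X : AddSubgroup G) : ℕ∞ :=
  ⨅ (k : ℕ) (_ : ∀ m ≥ k, Set.BijOn f (f^[m] '' (X : Set G)) (f^[m + 1] '' (X : Set G))), (k : ℕ∞)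

/-! ### Syzygies -/

variable [IsArtinianRing Λ]

/-- The projective cover `P(M)` of `M`. -/
def coverObj (M : FGModuleCat.{u} Λ) : FGModuleCat.{u} Λ := (exists_projectiveCover M).choose

/-- The canonical map `P(M) → M`. -/
def coverMap (M : FGModuleCat.{u} Λ) : coverObj M →ₗ[Λ] M :=
  (exists_projectiveCover M).choose_spec.choose

theorem coverMap_isProjectiveCover (M : FGModuleCat.{u} Λ) : IsProjectiveCover (coverMap M) :=
  (exists_projectiveCover M).choose_spec.choose_spec

/-- The syzygy `Ω M`: the kernel of the projective cover of `M`. -/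
def syzygy (M : FGModuleCat.{u} Λ) : FGModuleCat.{u} Λ :=
  FGModuleCat.of Λ (LinearMap.ker (coverMap M))

/-- The class `Ω^n (mod Λ)`. -/
def syzygyClass (Λ : Type u) [Ring Λ] [IsArtinianRing Λ] (n : ℕ) : Set (FGModuleCat.{u} Λ) :=
  Set.range (syzygy^[n])

theorem syzygy_prod {M X Y : FGModuleCat.{u} Λ} (e : M ≃ₗ[Λ] X × Y) :
    Nonempty (syzygy M ≃ₗ[Λ] syzygy X × syzygy Y) := by
  obtain ⟨f⟩ := (coverMap_isProjectiveCover M).ker_equiv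
    ((coverMap_isProjectiveCover X).prodMap (coverMap_isProjectiveCover Y)) e
  exact ⟨f.trans (kerProdMapEquiv _ _)⟩

theorem syzygy_projective {M : FGModuleCat.{u} Λ} (hM : Module.Projective Λ M) :
    Subsingleton (syzygy M) := by
  have hid : IsProjectiveCover (LinearMap.id : M →ₗ[Λ] M) :=
    ⟨hM, fun x => ⟨x, rfl⟩, fun N hN => by simpa using hN⟩
  obtain ⟨f⟩ := (coverMap_isProjectiveCover M).ker_equiv hid (LinearEquiv.refl Λ M)
  have : Subsingleton (LinearMap.ker (LinearMap.id : M →ₗ[Λ] M)) := by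
    rw [LinearMap.ker_id]; infer_instance
  exact f.toEquiv.subsingleton

/-! ### The syzygy operator on `K` and `K / ⟨𝒫⟩`, and the Igusa-Todorov function `Φ` -/

/-- The endomorphism `L` of `K` with `L [M] = [Ω M]`. -/
def syzygyHom (Λ : Type u) [Ring Λ] [IsArtinianRing Λ] : K Λ →+ K Λ :=
  QuotientAddGroup.lift (directSumRelations Λ)
    (FreeAbelianGroup.lift fun M : FGModuleCat.{u} Λ => cls (syzygy M)) (by
      refine (AddSubgroup.closure_le _).2 ?_
      rintro _ ⟨M, X, Y, ⟨e⟩, rfl⟩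
      simp [cls_prod (syzygy_prod e)])

theorem syzygyHom_cls (M : FGModuleCat.{u} Λ) : syzygyHom Λ (cls M) = cls (syzygy M) := by
  simp [syzygyHom, cls]

/-- The endomorphism of `K / ⟨𝒫⟩` induced by `L`. -/
def syzygyHomP (Λ : Type u) [Ring Λ] [IsArtinianRing Λ] : KP Λ →+ KP Λ :=
  QuotientAddGroup.map _ _ (syzygyHom Λ) (by
    refine (AddSubgroup.closure_le _).2 ?_
    rintro _ ⟨M, hM, -, rfl⟩
    have hM' : Module.Projective Λ M := by simpa [projClass] using hM
    change syzygyHom Λ (cls M) ∈ spanClass (projClass Λ)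
    rw [syzygyHom_cls, cls_subsingleton (syzygy_projective hM')]
    exact AddSubgroup.zero_mem _)

/-- The Igusa-Todorov function `Φ`. -/
def Phi (X : FGModuleCat.{u} Λ) : ℕ∞ :=
  eta (syzygyHomP Λ)
    ((spanClass (addClass X)).map (QuotientAddGroup.mk' (spanClass (projClass Λ))))

/-- The `Φ`-dimension of a class of modules. -/
def PhiDim (𝒳 : Set (FGModuleCat.{u} Λ)) : ℕ∞ := ⨆ X ∈ 𝒳, Phi X

end IgusaTodorov

end

open IgusaTodorov

noncomputable section

namespace IgusaTodorov

variable {Λ : Type u} [Ring Λ]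

/-! ### Summands and split epimorphisms -/

/-! Write `L̄` for the syzygy operator on `K / ⟨𝒫⟩`. Both upper bounds rest on `Φ(X) ≤ Φ(ΩX) + 1`
(`Phi_le_Phi_syzygy_add_one`): `L̄` sends the subgroup of `add X` into that of `add ΩX`, so
injectivity of `L̄` on the m-th image of the latter gives injectivity on the (m+1)-st image of the
former. Iterating, it suffices to find `k` with `Ω^k(Ω^n X) ∈ 𝒟` for all `X`, where `k` is at most
the resolution dimension in (a) and equals `id ω` in (b).

For (a), a module with a `𝒟`-resolution of length `r` has its r-th syzygy in `𝒟`. This is an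
induction using that the modules whose r-th syzygy lies in `𝒟` again form a left saturated class, by
the horseshoe lemma.

For (b), with `t = id ω`, part (a) puts some possibly large syzygy `Ω^(t+r) M` in `𝒟`, and `r` is
then lowered to `0`. If `ΩN ∈ 𝒟` and `Ext¹(N, ω) = 0`, embed `ΩN` in some `W ∈ ω` with cokernel in
`𝒟`. The pushout along `ΩN → P(N)` is an extension of objects of `𝒟`, and it splits as `W ⊕ N`, so
`N ∈ 𝒟`. Dimension shifting supplies the vanishing for `N = Ω^(t+r) M`.

For the lower bound, if `pd M = k + 1` then `Ω^k M` is not projective but `Ω^(k+1) M` is. So `L̄`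
kills a nonzero element of the k-th image, and `Φ(M) ≥ k + 1`. That nonprojective modules have
nonzero class follows from additivity of length, without Krull–Schmidt uniqueness. -/

theorem IsSummand.of_equiv {M N : FGModuleCat.{u} Λ} (e : N ≃ₗ[Λ] M) : IsSummand M N :=
  ⟨FGModuleCat.of Λ PUnit.{u + 1}, ⟨e.trans (LinearEquiv.prodUnique (R := Λ)).symm⟩⟩

theorem IsSummand.trans {M N P : FGModuleCat.{u} Λ} (h : IsSummand M N) (h' : IsSummand N P) :
    IsSummand M P := by
  obtain ⟨N', ⟨e⟩⟩ := h
  obtain ⟨P', ⟨e'⟩⟩ := h'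
  exact ⟨FGModuleCat.of Λ (N' × P'),
    ⟨e'.trans ((e.prodCongr (LinearEquiv.refl Λ P')).trans (LinearEquiv.prodAssoc Λ M N' P'))⟩⟩

theorem IsSummand.left {M X Y : FGModuleCat.{u} Λ} (e : M ≃ₗ[Λ] X × Y) : IsSummand X M :=
  ⟨Y, ⟨e⟩⟩

theorem IsSummand.right {M X Y : FGModuleCat.{u} Λ} (e : M ≃ₗ[Λ] X × Y) : IsSummand Y M :=
  ⟨X, ⟨e.trans (LinearEquiv.prodComm Λ X Y)⟩⟩

theorem closedUnderSummands_addClass (X : FGModuleCat.{u} Λ) :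
    ClosedUnderSummands (addClass X) := by
  rintro M N h ⟨s, hs⟩
  exact ⟨s, h.trans hs⟩

theorem self_mem_addClass (X : FGModuleCat.{u} Λ) : X ∈ addClass X :=
  ⟨1, .of_equiv (LinearEquiv.funUnique (Fin 1) Λ X)⟩

theorem projective_of_isSummand {M N : FGModuleCat.{u} Λ} (h : IsSummand M N)
    (hN : Module.Projective Λ N) : Module.Projective Λ M := by
  obtain ⟨N', ⟨e⟩⟩ := h
  refine Module.Projective.of_split (e.symm.toLinearMap ∘ₗ LinearMap.inl Λ M N')
    (LinearMap.fst Λ M N' ∘ₗ e.toLinearMap) ?_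
  ext x
  simp

theorem closedUnderSummands_projClass : ClosedUnderSummands (projClass Λ) :=
  fun _ _ h hN => projective_of_isSummand h hN

section

variable {P C M : Type u} [AddCommGroup P] [Module Λ P] [AddCommGroup C] [Module Λ C]
  [AddCommGroup M] [Module Λ M]

/-- If `h` is a split epimorphism with `κ ∘ h = π`, then `ker π` is the direct sum of `ker κ` and
`ker h`. -/
def kerCompEquiv (π : P →ₗ[Λ] M) (κ : C →ₗ[Λ] M) (h : P →ₗ[Λ] C) (s : C →ₗ[Λ] P)
    (hκ : ∀ p, κ (h p) = π p) (hs : ∀ c, h (s c) = c) :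
    LinearMap.ker π ≃ₗ[Λ] LinearMap.ker κ × LinearMap.ker h where
  toFun x := (⟨h x.1, by rw [LinearMap.mem_ker, hκ]; exact x.2⟩,
    ⟨x.1 - s (h x.1), by rw [LinearMap.mem_ker, map_sub, hs, sub_self]⟩)
  invFun y := ⟨s y.1.1 + y.2.1, by
    rw [LinearMap.mem_ker, ← hκ, map_add, hs, LinearMap.mem_ker.1 y.2.2, add_zero]
    exact y.1.2⟩
  map_add' x y := by
    ext <;> simp [add_sub_add_comm]
  map_smul' r x := by
    ext <;> simp [smul_sub]
  left_inv x := by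
    ext; simp
  right_inv y := by
    have := LinearMap.mem_ker.1 y.2.2
    ext <;> simp [hs, this]

theorem projective_ker_of_section [Module.Projective Λ P] (h : P →ₗ[Λ] C) (s : C →ₗ[Λ] P)
    (hs : ∀ c, h (s c) = c) : Module.Projective Λ (LinearMap.ker h) := by
  refine Module.Projective.of_split (LinearMap.ker h).subtype
    ((LinearMap.id - s ∘ₗ h).codRestrict (LinearMap.ker h) fun p => by
      simp [LinearMap.mem_ker, hs]) ?_
  ext x
  simp [LinearMap.mem_ker.1 x.2]

end

theorem IsLeftSaturated.of_equiv {𝒟 : Set (FGModuleCat.{u} Λ)} (h𝒟 : IsLeftSaturated 𝒟)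
    {M N : FGModuleCat.{u} Λ} (e : N ≃ₗ[Λ] M) (hN : N ∈ 𝒟) : M ∈ 𝒟 :=
  h𝒟.summands (.of_equiv e) hN

theorem IsLeftSaturated.prod {𝒟 : Set (FGModuleCat.{u} Λ)}
    (h𝒟 : IsLeftSaturated 𝒟) {M N : FGModuleCat.{u} Λ} (hM : M ∈ 𝒟) (hN : N ∈ 𝒟) :
    FGModuleCat.of Λ (M × N) ∈ 𝒟 :=
  h𝒟.extensions (X := M) (Y := FGModuleCat.of Λ (M × N)) (Z := N)
    (LinearMap.inl Λ M N) (LinearMap.snd Λ M N)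
    ⟨LinearMap.inl_injective, .inl_snd, LinearMap.snd_surjective⟩ hM hN

/-! ### Vanishing of extension groups and attained infima -/

theorem subsingleton_ext_of_projective {M : FGModuleCat.{u} Λ} (hM : Module.Projective Λ M)
    (Y : ModuleCat.{u} Λ) (j : ℕ) : Subsingleton (Abelian.Ext.{u} M.obj Y (j + 1)) := by
  have : Module.Projective Λ M.obj := hM
  exact Abelian.Ext.subsingleton_of_projective _ _ _

theorem subsingleton_ext_of_relId_le {𝒳 : Set (FGModuleCat.{u} Λ)} {W : FGModuleCat.{u} Λ} {t : ℕ}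
    (h : relId 𝒳 W ≤ t) {j : ℕ} (hj : t < j) {X : FGModuleCat.{u} Λ} (hX : X ∈ 𝒳) :
    Subsingleton (Abelian.Ext.{u} X.obj W.obj j) := by
  -- Passing to the strict bound `t + 1` extracts from the infimum an actual witness `n ≤ t`.
  have h' : relId 𝒳 W < ((t + 1 : ℕ) : ℕ∞) := h.trans_lt (Nat.cast_lt.2 t.lt_succ_self)
  obtain ⟨n, hn⟩ := iInf_lt_iff.1 h'
  obtain ⟨hn, hlt⟩ := iInf_lt_iff.1 hn
  have := Nat.cast_lt.1 hlt
  exact hn j (by omega) X hX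

theorem hasResolution_of_resdim_lt_top {𝒳 : Set (FGModuleCat.{u} Λ)} {M : FGModuleCat.{u} Λ}
    {r : ℕ∞} (hr : resdim 𝒳 M ≤ r) (hr' : r < ⊤) :
    ∃ k : ℕ, (k : ℕ∞) ≤ r ∧ HasResolution 𝒳 k M := by
  lift r to ℕ using hr'.ne
  have h' : resdim 𝒳 M < ((r + 1 : ℕ) : ℕ∞) := hr.trans_lt (Nat.cast_lt.2 r.lt_succ_self)
  obtain ⟨n, hn⟩ := iInf_lt_iff.1 h'
  obtain ⟨hn, hlt⟩ := iInf_lt_iff.1 hn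
  have := Nat.cast_lt.1 hlt
  exact ⟨n, Nat.cast_le.2 (by omega), hn⟩

/-! ### The class of a module in `K` and in `K / ⟨𝒫⟩` -/

variable [IsArtinianRing Λ]

theorem length_ne_top (M : FGModuleCat.{u} Λ) : Module.length Λ M ≠ ⊤ :=
  Module.length_ne_top_iff.2 (isFiniteLength_iff_isNoetherian_isArtinian.2
    ⟨inferInstance, inferInstance⟩)

theorem toNat_length_prod {M X Y : FGModuleCat.{u} Λ} (e : M ≃ₗ[Λ] X × Y) :
    (Module.length Λ M).toNat = (Module.length Λ X).toNat + (Module.length Λ Y).toNat := by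
  rw [e.length_eq, Module.length_prod, ENat.toNat_add (length_ne_top X) (length_ne_top Y)]

theorem toNat_length_eq_zero {M : FGModuleCat.{u} Λ} :
    (Module.length Λ M).toNat = 0 ↔ Subsingleton M := by
  rw [ENat.toNat_eq_zero, or_iff_left (length_ne_top M), Module.length_eq_zero_iff]

/-- In a class closed under direct summands every module is a direct sum of indecomposable modules
of the class. -/
theorem cls_mem_spanClass {𝒳 : Set (FGModuleCat.{u} Λ)} (h𝒳 : ClosedUnderSummands 𝒳)
    {M : FGModuleCat.{u} Λ} (hM : M ∈ 𝒳) : cls M ∈ spanClass 𝒳 := by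
  -- Induction on length: a nonzero decomposable module splits into two nonzero, hence strictly
  -- shorter, summands.
  induction hn : (Module.length Λ M).toNat using Nat.strong_induction_on generalizing M with
  | _ n ih =>
    by_cases hs : Subsingleton M
    · rw [cls_subsingleton hs]
      exact zero_mem _
    by_cases hi : IsIndecomposable M
    · exact AddSubgroup.subset_closure ⟨M, Or.inl hM, hi, rfl⟩
    have : ∃ X Y : FGModuleCat.{u} Λ, Nonempty (M ≃ₗ[Λ] X × Y) ∧
        ¬ Subsingleton X ∧ ¬ Subsingleton Y := by
      by_contra! h
      refine hi ⟨not_subsingleton_iff_nontrivial.1 hs, fun X Y e => ?_⟩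
      by_cases hX : Subsingleton X
      · exact Or.inl hX
      · exact Or.inr (not_nontrivial_iff_subsingleton.1 fun hY =>
          not_subsingleton_iff_nontrivial.2 hY
            (h X Y e (not_subsingleton_iff_nontrivial.1 hX)))
    obtain ⟨X, Y, ⟨e⟩, hX, hY⟩ := this
    have hl := toNat_length_prod e
    have hX0 := mt toNat_length_eq_zero.1 hX
    have hY0 := mt toNat_length_eq_zero.1 hY
    rw [cls_prod ⟨e⟩]
    exact add_mem (ih _ (by omega) (h𝒳 (.left e) hM) rfl) (ih _ (by omega) (h𝒳 (.right e) hM) rfl)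

/-- The length, as an additive function on `K`. -/
def lengthHom (Λ : Type u) [Ring Λ] [IsArtinianRing Λ] : K Λ →+ ℤ :=
  QuotientAddGroup.lift (directSumRelations Λ)
    (FreeAbelianGroup.lift fun M : FGModuleCat.{u} Λ => ((Module.length Λ M).toNat : ℤ)) (by
      refine (AddSubgroup.closure_le _).2 ?_
      rintro _ ⟨M, X, Y, ⟨e⟩, rfl⟩
      simp [toNat_length_prod e])

theorem lengthHom_cls (M : FGModuleCat.{u} Λ) :
    lengthHom Λ (cls M) = (Module.length Λ M).toNat := by
  exact (QuotientAddGroup.lift_mk' _ _ _).trans (FreeAbelianGroup.lift_apply_of _ _)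

/-- Length factors through `K` and vanishes only on zero modules. -/
theorem subsingleton_of_cls_eq_zero {M : FGModuleCat.{u} Λ} (h : cls M = 0) :
    Subsingleton M := by
  have := lengthHom_cls M
  rw [h, map_zero] at this
  exact toNat_length_eq_zero.1 (by exact_mod_cast this.symm)

theorem projective_of_subsingleton_syzygy {M : FGModuleCat.{u} Λ} (h : Subsingleton (syzygy M)) :
    Module.Projective Λ M := by
  have hc := coverMap_isProjectiveCover M
  have := hc.projective
  have hi : Function.Injective (coverMap M) := by
    rw [← LinearMap.ker_eq_bot]
    exact (Submodule.subsingleton_iff_eq_bot).1 h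
  exact Module.Projective.of_equiv (LinearEquiv.ofBijective (coverMap M) ⟨hi, hc.surjective⟩)

/-- The class of `M` in `K / ⟨𝒫⟩`. -/
def clsP (M : FGModuleCat.{u} Λ) : KP Λ := QuotientAddGroup.mk (cls M)

theorem syzygyHomP_clsP (M : FGModuleCat.{u} Λ) : syzygyHomP Λ (clsP M) = clsP (syzygy M) :=
  congrArg (QuotientAddGroup.mk (s := spanClass (projClass Λ))) (syzygyHom_cls M)

theorem syzygyHomP_iterate_clsP (k : ℕ) (M : FGModuleCat.{u} Λ) :
    (syzygyHomP Λ)^[k] (clsP M) = clsP (syzygy^[k] M) := by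
  induction k generalizing M with
  | zero => rfl
  | succ k ih => rw [Function.iterate_succ_apply, Function.iterate_succ_apply, syzygyHomP_clsP, ih]

theorem spanClass_projClass_le_ker : spanClass (projClass Λ) ≤ (syzygyHom Λ).ker := by
  refine (AddSubgroup.closure_le _).2 ?_
  rintro _ ⟨M, hM, -, rfl⟩
  have hM' : Module.Projective Λ M := by simpa [projClass] using hM
  change syzygyHom Λ (cls M) = 0
  rw [syzygyHom_cls, cls_subsingleton (syzygy_projective hM')]

/-- The operator on `K` kills `⟨𝒫⟩`, so a class in `⟨𝒫⟩` has `[ΩM] = 0` in `K` itself. Hence `ΩM =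
0`, and the projective cover of `M` is an isomorphism. -/
theorem clsP_eq_zero_iff {M : FGModuleCat.{u} Λ} : clsP M = 0 ↔ Module.Projective Λ M := by
  rw [clsP, QuotientAddGroup.eq_zero_iff]
  refine ⟨fun h => projective_of_subsingleton_syzygy (subsingleton_of_cls_eq_zero ?_),
    fun h => cls_mem_spanClass closedUnderSummands_projClass h⟩
  rw [← syzygyHom_cls]
  exact spanClass_projClass_le_ker h

/-! ### The Igusa-Todorov function and syzygies -/

theorem IsSummand.syzygy {M N : FGModuleCat.{u} Λ} (h : IsSummand M N) :
    IsSummand (syzygy M) (syzygy N) := by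
  obtain ⟨N', ⟨e⟩⟩ := h
  exact ⟨_, syzygy_prod e⟩

theorem syzygy_pow (X : FGModuleCat.{u} Λ) (s : ℕ) :
    Nonempty (syzygy (FGModuleCat.of Λ (Fin s → X)) ≃ₗ[Λ] (Fin s → syzygy X)) := by
  induction s with
  | zero =>
    have : Subsingleton (syzygy (FGModuleCat.of Λ (Fin 0 → X))) :=
      syzygy_projective (inferInstanceAs (Module.Projective Λ (Fin 0 → X)))
    exact ⟨LinearEquiv.ofSubsingleton _ _⟩
  | succ s ih =>
    obtain ⟨e⟩ := ih
    obtain ⟨f⟩ := syzygy_prod (M := FGModuleCat.of Λ (Fin (s + 1) → X)) (X := X)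
      (Y := FGModuleCat.of Λ (Fin s → X)) (Fin.consLinearEquiv Λ fun _ => X).symm
    exact ⟨(f.trans ((LinearEquiv.refl Λ _).prodCongr e)).trans
      (Fin.consLinearEquiv Λ fun _ => syzygy X)⟩

theorem syzygy_mem_addClass {M X : FGModuleCat.{u} Λ} (h : M ∈ addClass X) :
    syzygy M ∈ addClass (syzygy X) := by
  obtain ⟨s, hs⟩ := h
  obtain ⟨e⟩ := syzygy_pow X s
  exact ⟨s, hs.syzygy.trans (.of_equiv (N := FGModuleCat.of Λ (Fin s → syzygy X)) e.symm)⟩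

/-- The image of `⟨add X⟩` in `K / ⟨𝒫⟩`. -/
def addSpanP (X : FGModuleCat.{u} Λ) : AddSubgroup (KP Λ) :=
  (spanClass (addClass X)).map (QuotientAddGroup.mk' (spanClass (projClass Λ)))

theorem clsP_mem_addSpanP {M X : FGModuleCat.{u} Λ} (h : M ∈ addClass X) : clsP M ∈ addSpanP X :=
  ⟨cls M, cls_mem_spanClass (closedUnderSummands_addClass X) h, rfl⟩

theorem map_syzygyHomP_addSpanP_le (X : FGModuleCat.{u} Λ) :
    (addSpanP X).map (syzygyHomP Λ) ≤ addSpanP (syzygy X) := by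
  rw [addSpanP, AddSubgroup.map_map, AddSubgroup.map_le_iff_le_comap]
  refine (AddSubgroup.closure_le _).2 ?_
  rintro _ ⟨M, hM | hM, -, rfl⟩
  · change syzygyHomP Λ (clsP M) ∈ addSpanP (syzygy X)
    rw [syzygyHomP_clsP]
    exact clsP_mem_addSpanP (syzygy_mem_addClass hM)
  · change syzygyHomP Λ (clsP M) ∈ addSpanP (syzygy X)
    rw [clsP_eq_zero_iff.2 hM, map_zero]
    exact zero_mem _

theorem Phi_le_Phi_syzygy_add_one (X : FGModuleCat.{u} Λ) : Phi X ≤ Phi (syzygy X) + 1 := by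
  change Phi X ≤ eta _ (addSpanP (syzygy X)) + 1
  rw [eta, ENat.iInf_add]
  refine le_iInf fun k => ?_
  rw [ENat.iInf_add]
  refine le_iInf fun hk => ?_
  refine iInf₂_le_of_le (k + 1) (fun m hm => ?_) (by push_cast; exact le_rfl)
  obtain ⟨m, rfl⟩ : ∃ j, m = j + 1 := ⟨m - 1, by omega⟩
  change Set.BijOn _ (_ '' (addSpanP X : Set (KP Λ))) (_ '' (addSpanP X : Set (KP Λ)))
  have hsub : (syzygyHomP Λ)^[m + 1] '' (addSpanP X : Set (KP Λ)) ⊆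
      (syzygyHomP Λ)^[m] '' (addSpanP (syzygy X) : Set (KP Λ)) := by
    rintro _ ⟨x, hx, rfl⟩
    exact ⟨_, map_syzygyHomP_addSpanP_le X ⟨x, hx, rfl⟩, rfl⟩
  -- Surjectivity onto the next image is automatic; only injectivity has to be inherited, via the
  -- inclusion `hsub`.
  rw [Function.iterate_succ' _ (m + 1), Set.image_comp]
  exact ((hk m (by omega)).injOn.mono hsub).bijOn_image

theorem Phi_le_Phi_syzygy_iterate_add (k : ℕ) (X : FGModuleCat.{u} Λ) :
    Phi X ≤ Phi (syzygy^[k] X) + k := by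
  induction k generalizing X with
  | zero => simp
  | succ k ih =>
    rw [Function.iterate_succ_apply]
    refine (Phi_le_Phi_syzygy_add_one X).trans ?_
    push_cast
    rw [← add_assoc]
    gcongr
    exact ih _

/-- The class of `Ω^k M` is a nonzero element of the k-th image killed by `L̄`, so injectivity fails
at `m = k` and no threshold `j ≤ k` is admissible. -/
theorem succ_le_Phi {k : ℕ} {M : FGModuleCat.{u} Λ}
    (h : ¬ Module.Projective Λ (syzygy^[k] M : FGModuleCat.{u} Λ))
    (h' : Module.Projective Λ (syzygy^[k + 1] M : FGModuleCat.{u} Λ)) :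
    ((k + 1 : ℕ) : ℕ∞) ≤ Phi M := by
  refine le_iInf₂ fun j hj => ?_
  by_contra! hlt
  have hjk : j ≤ k := by
    have := Nat.cast_lt.1 hlt
    omega
  refine h (clsP_eq_zero_iff.1 ((hj k hjk).injOn
    ⟨clsP M, clsP_mem_addSpanP (self_mem_addClass M), syzygyHomP_iterate_clsP k M⟩
    ⟨0, zero_mem (addSpanP M), iterate_map_zero (syzygyHomP Λ) k⟩ ?_))
  rw [map_zero, syzygyHomP_clsP, ← Function.iterate_succ_apply' syzygy, clsP_eq_zero_iff]
  exact h'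

/-! ### Syzygies and left saturated classes -/

/-- The lift `P → P(M)` is onto because its image and the superfluous kernel together span `P(M)`.
It therefore splits, with projective kernel `Q`. -/
theorem exists_ker_equiv_syzygy_prod {P M : FGModuleCat.{u} Λ} (hP : Module.Projective Λ P)
    (π : P →ₗ[Λ] M) (hπ : Function.Surjective π) :
    ∃ Q : FGModuleCat.{u} Λ, Module.Projective Λ Q ∧
      Nonempty (LinearMap.ker π ≃ₗ[Λ] syzygy M × Q) := by
  have hc := coverMap_isProjectiveCover M
  have := hc.projective
  obtain ⟨h, hh⟩ := Module.projective_lifting_property (coverMap M) π hc.surjective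
  have hh' : ∀ p, coverMap M (h p) = π p := fun p => LinearMap.congr_fun hh p
  have hs : Function.Surjective h := by
    rw [← LinearMap.range_eq_top]
    refine hc.superfluous _ (top_le_iff.1 fun x _ => ?_)
    obtain ⟨p, hp⟩ := hπ (coverMap M x)
    refine Submodule.mem_sup.2 ⟨h p, ⟨p, rfl⟩, x - h p, ?_, by abel⟩
    rw [LinearMap.mem_ker, map_sub, hh', hp, sub_self]
  obtain ⟨s, hs⟩ := Module.projective_lifting_property h LinearMap.id hs
  have hs' : ∀ c, h (s c) = c := fun c => LinearMap.congr_fun hs c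
  exact ⟨FGModuleCat.of Λ (LinearMap.ker h), projective_ker_of_section h s hs',
    ⟨kerCompEquiv π (coverMap M) h s hh' hs'⟩⟩

/-- The horseshoe lemma. -/
theorem exists_syzygy_shortExact {X Y Z : FGModuleCat.{u} Λ} {f : X →ₗ[Λ] Y} {g : Y →ₗ[Λ] Z}
    (h : IsShortExact f g) :
    ∃ Q : FGModuleCat.{u} Λ, Module.Projective Λ Q ∧
      ∃ (f' : syzygy X →ₗ[Λ] FGModuleCat.of Λ (syzygy Y × Q))
        (g' : FGModuleCat.of Λ (syzygy Y × Q) →ₗ[Λ] syzygy Z), IsShortExact f' g' := by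
  obtain ⟨hf, hfg, hg⟩ := h
  have hX := coverMap_isProjectiveCover X
  have hZ := coverMap_isProjectiveCover Z
  have := hX.projective
  have := hZ.projective
  obtain ⟨l, hl⟩ := Module.projective_lifting_property g (coverMap Z) hg
  have hl' : ∀ p, g (l p) = coverMap Z p := fun p => LinearMap.congr_fun hl p
  have hgf : ∀ x, g (f x) = 0 := hfg.apply_apply_eq_zero
  -- This epimorphism from a projective need not be a projective cover of `Y`, whence the extra
  -- summand `Q`.
  let π : coverObj X × coverObj Z →ₗ[Λ] Y := (f ∘ₗ coverMap X).coprod l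
  have hπ' : ∀ p q, π (p, q) = f (coverMap X p) + l q := fun p q => rfl
  have hπ : Function.Surjective π := by
    intro y
    obtain ⟨q, hq⟩ := hZ.surjective (g y)
    obtain ⟨x, hx⟩ := (hfg (y - l q)).1 (by rw [map_sub, hl', hq, sub_self])
    obtain ⟨p, hp⟩ := hX.surjective x
    exact ⟨(p, q), by rw [hπ', hp, hx]; abel⟩
  obtain ⟨Q, hQ, ⟨e⟩⟩ := exists_ker_equiv_syzygy_prod
    (P := FGModuleCat.of Λ (coverObj X × coverObj Z))
    (inferInstanceAs (Module.Projective Λ (coverObj X × coverObj Z))) π hπ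
  let u : syzygy X →ₗ[Λ] LinearMap.ker π :=
    (LinearMap.inl Λ (coverObj X) (coverObj Z) ∘ₗ (LinearMap.ker (coverMap X)).subtype).codRestrict
      (LinearMap.ker π) fun x => by
        change f (coverMap X x.1) + l 0 = 0
        rw [LinearMap.mem_ker.1 x.2, map_zero, map_zero, add_zero]
  have hgπ : ∀ z : LinearMap.ker π, coverMap Z z.1.2 = 0 := by
    intro z
    have := congrArg g (LinearMap.mem_ker.1 z.2)
    rwa [hπ' z.1.1 z.1.2, map_add, hgf, zero_add, hl', map_zero] at this
  let v : LinearMap.ker π →ₗ[Λ] syzygy Z :=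
    (LinearMap.snd Λ (coverObj X) (coverObj Z) ∘ₗ (LinearMap.ker π).subtype).codRestrict
      (LinearMap.ker (coverMap Z)) hgπ
  refine ⟨Q, hQ, e.toLinearMap ∘ₗ u, v ∘ₗ e.symm.toLinearMap, ?_, ?_, ?_⟩
  · refine e.injective.comp fun x y hxy => Subtype.ext ?_
    exact congrArg (fun z : LinearMap.ker π => z.1.1) hxy
  · intro w
    obtain ⟨z, rfl⟩ := e.surjective w
    constructor
    · intro hz
      have hz' : z.1.2 = 0 := by
        have : v (e.symm (e z)) = 0 := hz
        rw [e.symm_apply_apply] at this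
        exact congrArg Subtype.val this
      have hz1 : coverMap X z.1.1 = 0 := hf (by
        have := LinearMap.mem_ker.1 z.2
        rw [hπ' z.1.1 z.1.2, hz', map_zero, add_zero] at this
        rw [this, map_zero])
      exact ⟨⟨z.1.1, hz1⟩, congrArg e (Subtype.ext (Prod.ext rfl hz'.symm))⟩
    · rintro ⟨x, hx⟩
      have hx' : u x = z := e.injective hx
      change v (e.symm (e z)) = 0
      rw [e.symm_apply_apply, ← hx']
      rfl
  · intro q
    obtain ⟨x, hx⟩ := (hfg (l q.1)).1 (by rw [hl']; exact q.2)
    obtain ⟨p, hp⟩ := hX.surjective x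
    have hz : ((-p, q.1) : coverObj X × coverObj Z) ∈ LinearMap.ker π := by
      rw [LinearMap.mem_ker, hπ', map_neg, map_neg, hp, hx, neg_add_cancel]
    refine ⟨e ⟨_, hz⟩, ?_⟩
    change v (e.symm (e ⟨_, hz⟩)) = q
    rw [e.symm_apply_apply]
    rfl

theorem cover_shortExact (M : FGModuleCat.{u} Λ) :
    IsShortExact (X := syzygy M) (Y := coverObj M) (LinearMap.ker (coverMap M)).subtype
      (coverMap M) :=
  ⟨Subtype.val_injective, LinearMap.exact_subtype_ker_map _,
    (coverMap_isProjectiveCover M).surjective⟩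

namespace IsLeftSaturated

variable {𝒟 : Set (FGModuleCat.{u} Λ)}

theorem coverObj_mem (h𝒟 : IsLeftSaturated 𝒟) (M : FGModuleCat.{u} Λ) : coverObj M ∈ 𝒟 :=
  h𝒟.projectives (coverMap_isProjectiveCover M).projective

theorem syzygy_mem (h𝒟 : IsLeftSaturated 𝒟) {M : FGModuleCat.{u} Λ} (hM : M ∈ 𝒟) :
    syzygy M ∈ 𝒟 :=
  h𝒟.kernels _ _ (cover_shortExact M) (h𝒟.coverObj_mem M) hM

theorem syzygy_iterate_mem (h𝒟 : IsLeftSaturated 𝒟) (k : ℕ) {M : FGModuleCat.{u} Λ}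
    (hM : M ∈ 𝒟) : syzygy^[k] M ∈ 𝒟 := by
  induction k with
  | zero => exact hM
  | succ k ih => rw [Function.iterate_succ_apply']; exact h𝒟.syzygy_mem ih

/-- The horseshoe sequence has middle term `ΩY ⊕ Q`; the projective `Q` is harmless, since `𝒟`
contains projectives and is closed under sums and summands. -/
theorem preimage_syzygy (h𝒟 : IsLeftSaturated 𝒟) : IsLeftSaturated (syzygy ⁻¹' 𝒟) where
  extensions X Y Z f g h hX hZ := by
    obtain ⟨Q, hQ, f', g', h'⟩ := exists_syzygy_shortExact h
    exact h𝒟.summands (.left (LinearEquiv.refl Λ _)) (h𝒟.extensions f' g' h' hX hZ)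
  kernels X Y Z f g h hY hZ := by
    obtain ⟨Q, hQ, f', g', h'⟩ := exists_syzygy_shortExact h
    exact h𝒟.kernels f' g' h' (h𝒟.prod hY (h𝒟.projectives hQ)) hZ
  projectives P hP := h𝒟.syzygy_mem (h𝒟.projectives hP)
  summands _ _ h hN := h𝒟.summands h.syzygy hN

theorem preimage_syzygy_iterate (h𝒟 : IsLeftSaturated 𝒟) (k : ℕ) :
    IsLeftSaturated (syzygy^[k] ⁻¹' 𝒟) := by
  induction k with
  | zero => exact h𝒟
  | succ k ih => exact ih.preimage_syzygy

theorem syzygy_iterate_mem_of_hasResolution (h𝒟 : IsLeftSaturated 𝒟) {r : ℕ}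
    {M : FGModuleCat.{u} Λ} (h : HasResolution 𝒟 r M) : syzygy^[r] M ∈ 𝒟 := by
  induction r generalizing M with
  | zero =>
    obtain ⟨X, d, ε, hX, h0, hε, hd, -⟩ := h
    have := h0 1 (by omega)
    have hi : Function.Injective ε := by
      rw [injective_iff_map_eq_zero]
      intro x hx
      obtain ⟨y, rfl⟩ := (hd x).1 hx
      rw [Subsingleton.elim y 0, map_zero]
    exact h𝒟.of_equiv (LinearEquiv.ofBijective ε ⟨hi, hε⟩) (hX 0 le_rfl)
  | succ r ih =>
    obtain ⟨X, d, ε, hX, h0, hε, hd0, hd⟩ := h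
    -- The kernel of `ε` has the shifted resolution, of length `r`.
    let N : FGModuleCat.{u} Λ := FGModuleCat.of Λ (LinearMap.ker ε)
    have hN : syzygy^[r] N ∈ 𝒟 := by
      refine ih ⟨fun i => X (i + 1), fun i => d (i + 1),
        (d 0).codRestrict (LinearMap.ker ε) hd0.apply_apply_eq_zero,
        fun i hi => hX _ (by omega), fun i hi => h0 _ (by omega), ?_, ?_, fun i => hd (i + 1)⟩
      · intro x
        obtain ⟨y, hy⟩ := (hd0 x.1).1 x.2
        exact ⟨y, Subtype.ext hy⟩
      · intro x
        rw [← hd 0 x]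
        exact Subtype.ext_iff
    have hr := h𝒟.preimage_syzygy_iterate r
    have hX0 : X 0 ∈ syzygy^[r] ⁻¹' 𝒟 := h𝒟.syzygy_iterate_mem r (hX 0 (by omega))
    have hc := coverMap_isProjectiveCover M
    have := hc.projective
    obtain ⟨l, hl⟩ := Module.projective_lifting_property ε (coverMap M) hε
    have hl' : ∀ p, ε (l p) = coverMap M p := fun p => LinearMap.congr_fun hl p
    -- The pullback of `ε` and `P(M) → M` splits over `P(M)` through the lift `l`, giving `0 → ΩM →
    -- N ⊕ P(M) → X 0 → 0`. The last two terms lie in the left saturated class of modules with r-th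
    -- syzygy in `𝒟`.
    refine hr.kernels (X := syzygy M) (Y := FGModuleCat.of Λ (N × coverObj M)) (Z := X 0)
      (((l ∘ₗ (LinearMap.ker (coverMap M)).subtype).codRestrict (LinearMap.ker ε) fun p => by
        rw [LinearMap.mem_ker]; exact (hl' _).trans p.2).prod (LinearMap.ker (coverMap M)).subtype)
      ((-(LinearMap.ker ε).subtype).coprod l) ⟨?_, ?_, ?_⟩
      (hr.prod hN (hr.coverObj_mem M)) hX0
    · intro x y hxy
      exact Subtype.ext (congrArg Prod.snd hxy)
    · rintro ⟨k, p⟩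
      constructor
      · intro h
        have h' : -k.1 + l p = 0 := h
        have hk : l p = k.1 := (neg_add_eq_zero.1 h').symm
        refine ⟨⟨p, ?_⟩, Prod.ext (Subtype.ext hk) rfl⟩
        rw [LinearMap.mem_ker, ← hl', hk]
        exact k.2
      · rintro ⟨x, hx⟩
        obtain ⟨rfl, rfl⟩ := Prod.mk.inj hx
        exact neg_add_cancel (l x.1)
    · intro x
      obtain ⟨p, hp⟩ := hc.surjective (ε x)
      refine ⟨(⟨l p - x, ?_⟩, p), ?_⟩
      · rw [LinearMap.mem_ker, map_sub, hl', hp, sub_self]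
      · change -(l p - x) + l p = x
        abel

/-- If `ω` is a relative cogenerator in `𝒟`, `Ω N` lies in `𝒟` and all maps from `Ω N` to modules
of `ω` extend to the projective cover of `N`, then `N` lies in `𝒟`. -/
theorem mem_of_syzygy_mem (h𝒟 : IsLeftSaturated 𝒟) {ω : Set (FGModuleCat.{u} Λ)}
    (hω : IsInjectiveRelativeCogenerator 𝒟 ω) {N : FGModuleCat.{u} Λ} (hN : syzygy N ∈ 𝒟)
    (hext : ∀ W ∈ ω, ∀ f : syzygy N →ₗ[Λ] W, ∃ h : coverObj N →ₗ[Λ] W,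
      h ∘ₗ (LinearMap.ker (coverMap N)).subtype = f) : N ∈ 𝒟 := by
  obtain ⟨W, hW, X', hX', f, g, hf, hfg, hg⟩ := hω.cogenerator _ hN
  obtain ⟨h, hh⟩ := hext W hW f
  have hh' : ∀ x : syzygy N, h x.1 = f x := fun x => LinearMap.congr_fun hh x
  have hc := coverMap_isProjectiveCover N
  have hker : LinearMap.ker (coverMap N) ≤ LinearMap.ker (g ∘ₗ h) := fun x hx =>
    (congrArg g (hh' ⟨x, hx⟩)).trans (hfg.apply_apply_eq_zero _)
  -- The map induced by `h` on cokernels of the embeddings of `ΩN` in `P(N)` and in `W`.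
  let q : N →ₗ[Λ] X' := (LinearMap.ker (coverMap N)).liftQ (g ∘ₗ h) hker ∘ₗ
    ((coverMap N).quotKerEquivOfSurjective hc.surjective).symm.toLinearMap
  have hq : ∀ p, q (coverMap N p) = g (h p) := by
    intro p
    change Submodule.liftQ _ _ hker (((coverMap N).quotKerEquivOfSurjective hc.surjective).symm _) = _
    have : ((coverMap N).quotKerEquivOfSurjective hc.surjective).symm (coverMap N p) =
        Submodule.Quotient.mk p := by
      rw [LinearEquiv.symm_apply_eq]
      rfl
    rw [this]
    rfl
  refine h𝒟.summands (.right (LinearEquiv.refl Λ (W × N)) (M := FGModuleCat.of Λ (W × N))) ?_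
  -- The pushout of `W ← ΩN → P(N)`, identified with `W ⊕ N` by means of `h`, is an extension of
  -- `X'` by `P(N)`.
  refine h𝒟.extensions (X := coverObj N) (Y := FGModuleCat.of Λ (W × N)) (Z := X')
    (h.prod (coverMap N)) (g.coprod (-q)) ⟨?_, ?_, ?_⟩ (h𝒟.coverObj_mem N) hX'
  · rw [injective_iff_map_eq_zero]
    intro p hp
    obtain ⟨hp1, hp2⟩ := Prod.mk.inj hp
    have : f ⟨p, hp2⟩ = 0 := (hh' ⟨p, hp2⟩).symm.trans hp1
    exact congrArg Subtype.val ((injective_iff_map_eq_zero f).1 hf _ this)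
  · rintro ⟨w, y⟩
    obtain ⟨p, rfl⟩ := hc.surjective y
    constructor
    · intro hw
      have hw' : g w + -q (coverMap N p) = 0 := hw
      rw [hq, add_neg_eq_zero] at hw'
      obtain ⟨k, hk⟩ := (hfg (w - h p)).1 (by rw [map_sub, hw', sub_self])
      refine ⟨p + k.1, Prod.ext ?_ ?_⟩
      · change h (p + k.1) = w
        rw [map_add, hh', hk]
        abel
      · change coverMap N (p + k.1) = coverMap N p
        rw [map_add, LinearMap.mem_ker.1 k.2, add_zero]
    · rintro ⟨p', hp'⟩
      obtain ⟨rfl, h2⟩ := Prod.mk.inj hp'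
      change g (h p') + -q (coverMap N p) = 0
      rw [← h2, hq, add_neg_cancel]
  · intro x
    obtain ⟨w, rfl⟩ := hg x
    exact ⟨(w, 0), by change g w + -q 0 = g w; rw [map_zero, neg_zero, add_zero]⟩

end IsLeftSaturated

/-! ### Extension groups and syzygies -/

/-- The short exact sequence `0 → Ω M → P(M) → M → 0`. -/
def coverSequence (M : FGModuleCat.{u} Λ) : ShortComplex (ModuleCat.{u} Λ) :=
  ShortComplex.moduleCatMk (LinearMap.ker (coverMap M)).subtype (coverMap M) (by ext x; exact x.2)

theorem coverSequence_shortExact (M : FGModuleCat.{u} Λ) : (coverSequence M).ShortExact :=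
  ModuleCat.shortComplex_shortExact _ (LinearMap.exact_subtype_ker_map _) Subtype.val_injective
    (coverMap_isProjectiveCover M).surjective

theorem coverSequence_projective (M : FGModuleCat.{u} Λ) : Projective (coverSequence M).X₂ := by
  have : Module.Projective Λ (coverSequence M).X₂ := (coverMap_isProjectiveCover M).projective
  infer_instance

/-- Dimension shifting; degrees start at `1` on the syzygy side because the `Ext` groups of `P(M)`
vanish only in positive degrees. -/
theorem subsingleton_ext_succ_iff (M : FGModuleCat.{u} Λ) (Y : ModuleCat.{u} Λ) (j : ℕ) :
    Subsingleton (Abelian.Ext.{u} M.obj Y (j + 1 + 1)) ↔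
      Subsingleton (Abelian.Ext.{u} (syzygy M).obj Y (j + 1)) := by
  have hS := coverSequence_shortExact M
  have := coverSequence_projective M
  change Subsingleton (Abelian.Ext.{u} (coverSequence M).X₃ Y (j + 1 + 1)) ↔
      Subsingleton (Abelian.Ext.{u} (coverSequence M).X₁ Y (j + 1))
  constructor
  · intro h
    refine subsingleton_of_forall_eq 0 fun x => ?_
    obtain ⟨y, rfl⟩ := Abelian.Ext.contravariant_sequence_exact₁ hS Y x (add_comm 1 (j + 1))
      (Subsingleton.elim _ _)
    rw [Abelian.Ext.eq_zero_of_projective y, Abelian.Ext.comp_zero]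
  · intro h
    refine subsingleton_of_forall_eq 0 fun x => ?_
    obtain ⟨y, rfl⟩ := Abelian.Ext.contravariant_sequence_exact₃ hS Y x
      (Abelian.Ext.eq_zero_of_projective _) (add_comm 1 (j + 1))
    rw [Subsingleton.elim y 0, Abelian.Ext.comp_zero]

theorem subsingleton_ext_add_iff (k : ℕ) (M : FGModuleCat.{u} Λ) (Y : ModuleCat.{u} Λ) (j : ℕ) :
    Subsingleton (Abelian.Ext.{u} M.obj Y (j + 1 + k)) ↔
      Subsingleton (Abelian.Ext.{u} (syzygy^[k] M).obj Y (j + 1)) := by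
  induction k generalizing M with
  | zero => rfl
  | succ k ih =>
    rw [Function.iterate_succ_apply, ← ih, show j + 1 + (k + 1) = (j + k) + 1 + 1 by omega,
      subsingleton_ext_succ_iff, show j + k + 1 = j + 1 + k by omega]

/-- The obstruction to extending `f` is its image under the connecting map into `Ext¹(M, Y)`. -/
theorem exists_extension_of_subsingleton_ext {M Y : FGModuleCat.{u} Λ}
    (h : Subsingleton (Abelian.Ext.{u} M.obj Y.obj 1)) (f : syzygy M →ₗ[Λ] Y) :
    ∃ l : coverObj M →ₗ[Λ] Y, l ∘ₗ (LinearMap.ker (coverMap M)).subtype = f := by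
  have hS := coverSequence_shortExact M
  let F : (coverSequence M).X₁ ⟶ Y.obj := ModuleCat.ofHom f
  have h' : Subsingleton (Abelian.Ext.{u} (coverSequence M).X₃ Y.obj 1) := h
  obtain ⟨y, hy⟩ := Abelian.Ext.contravariant_sequence_exact₁ hS Y.obj (Abelian.Ext.mk₀ F)
    (add_zero 1) (Subsingleton.elim _ _)
  obtain ⟨l, rfl⟩ := Abelian.Ext.homEquiv₀.symm.surjective y
  change (Abelian.Ext.mk₀ _).comp (Abelian.Ext.mk₀ l) _ = _ at hy
  rw [Abelian.Ext.mk₀_comp_mk₀] at hy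
  have := Abelian.Ext.homEquiv₀.symm.injective hy
  exact ⟨l.hom, congrArg ModuleCat.Hom.hom this⟩

/-- Extending the identity of `ΩM` gives a retraction `l : P(M) → ΩM`. Its kernel and the
superfluous `ΩM` span `P(M)`, so `l = 0` and `ΩM = 0`. -/
theorem projective_of_subsingleton_ext {M : FGModuleCat.{u} Λ}
    (h : Subsingleton (Abelian.Ext.{u} M.obj (syzygy M).obj 1)) : Module.Projective Λ M := by
  obtain ⟨l, hl⟩ := exists_extension_of_subsingleton_ext h LinearMap.id
  have hl' : ∀ x : syzygy M, l x.1 = x := fun x => LinearMap.congr_fun hl x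
  have hc := coverMap_isProjectiveCover M
  have := hc.projective
  have hk : LinearMap.ker l = ⊤ := by
    refine hc.superfluous _ (top_le_iff.1 fun x _ => ?_)
    refine Submodule.mem_sup.2 ⟨x - (l x).1, ?_, (l x).1, (l x).2, by abel⟩
    rw [LinearMap.mem_ker, map_sub, hl', sub_self]
  refine projective_of_subsingleton_syzygy ⟨fun x y => ?_⟩
  rw [← hl' x, ← hl' y, LinearMap.ker_eq_top.1 hk]
  rfl

/-! ### Comparison of the dimensions -/

theorem finDim_le_PhiDim (Λ : Type u) [Ring Λ] [IsArtinianRing Λ] :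
    finDim Λ ≤ PhiDim (Set.univ : Set (FGModuleCat.{u} Λ)) := by
  classical
  refine iSup₂_le fun M hM => le_trans ?_ (le_iSup₂_of_le M (Set.mem_univ M) le_rfl)
  have hex : ∃ n : ℕ, ∀ j : ℕ, n < j → ∀ X ∈ (Set.univ : Set (FGModuleCat.{u} Λ)),
      Subsingleton (Abelian.Ext.{u} M.obj X.obj j) := by
    obtain ⟨n, hn⟩ := iInf_lt_iff.1 hM
    obtain ⟨h, -⟩ := iInf_lt_iff.1 hn
    exact ⟨n, h⟩
  obtain ⟨n, hn⟩ : ∃ n, n = Nat.find hex := ⟨_, rfl⟩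
  refine (iInf₂_le n (hn ▸ Nat.find_spec hex)).trans ?_
  cases n with
  | zero => simp
  | succ k =>
    refine succ_le_Phi (fun hk => ?_) (projective_of_subsingleton_ext ?_)
    -- If `Ω^k M` were projective, shifting would make `Ext^j(M, -)` vanish for all `j > k`, against
    -- the minimality of `n = k + 1`.
    · refine Nat.find_min hex (m := k) (by omega) fun j hj X _ => ?_
      obtain ⟨i, rfl⟩ : ∃ i, j = i + 1 + k := ⟨j - k - 1, by omega⟩
      rw [subsingleton_ext_add_iff]
      exact subsingleton_ext_of_projective hk _ _
    -- `Ext¹` of `Ω^(k+1) M` is `Ext` of `M` in degree `k + 2 > n`.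
    · rw [← subsingleton_ext_add_iff (k + 1) M _ 0]
      exact (hn ▸ Nat.find_spec hex) _ (by omega) _ (Set.mem_univ _)

theorem Phi_le_of_syzygy_iterate_mem {𝒟 : Set (FGModuleCat.{u} Λ)} {n k : ℕ}
    {X : FGModuleCat.{u} Λ} (h : syzygy^[k] (syzygy^[n] X) ∈ 𝒟) :
    Phi X ≤ k + PhiDim 𝒟 + n := by
  refine (Phi_le_Phi_syzygy_iterate_add n X).trans ?_
  gcongr
  refine (Phi_le_Phi_syzygy_iterate_add k _).trans ?_
  rw [add_comm]
  gcongr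
  exact le_iSup₂_of_le (f := fun X (_ : X ∈ 𝒟) => Phi X) _ h le_rfl

theorem PhiDim_le_resdimClass_add {𝒟 : Set (FGModuleCat.{u} Λ)} (h𝒟 : IsLeftSaturated 𝒟) (n : ℕ) :
    PhiDim (Set.univ : Set (FGModuleCat.{u} Λ)) ≤
      resdimClass 𝒟 (syzygyClass Λ n) + PhiDim 𝒟 + n := by
  rcases eq_or_ne (resdimClass 𝒟 (syzygyClass Λ n)) ⊤ with htop | htop
  · simp [htop]
  refine iSup₂_le fun X _ => ?_
  have hle : resdim 𝒟 (syzygy^[n] X) ≤ resdimClass 𝒟 (syzygyClass Λ n) :=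
    le_iSup₂_of_le (f := fun Y (_ : Y ∈ syzygyClass Λ n) => resdim 𝒟 Y) _ ⟨X, rfl⟩ le_rfl
  obtain ⟨k, hk, hres⟩ := hasResolution_of_resdim_lt_top hle htop.lt_top
  refine (Phi_le_of_syzygy_iterate_mem (h𝒟.syzygy_iterate_mem_of_hasResolution hres)).trans ?_
  gcongr

theorem IsLeftSaturated.syzygy_iterate_mem_of_idClass_le {𝒟 ω : Set (FGModuleCat.{u} Λ)}
    (h𝒟 : IsLeftSaturated 𝒟) (hω : IsInjectiveRelativeCogenerator 𝒟 ω) {t : ℕ}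
    (ht : idClass ω ≤ t) {M : FGModuleCat.{u} Λ} (hM : M ∈ finResdim 𝒟) :
    syzygy^[t] M ∈ 𝒟 := by
  obtain ⟨r, -, hres⟩ := hasResolution_of_resdim_lt_top le_rfl hM
  have hr : syzygy^[t + r] M ∈ 𝒟 := by
    rw [Function.iterate_add_apply]
    exact h𝒟.syzygy_iterate_mem t (h𝒟.syzygy_iterate_mem_of_hasResolution hres)
  -- The resolution only supplies a starting `r`; the descent uses membership of `Ω^(t+r) M` alone.
  clear hres
  induction r with
  | zero => exact hr
  | succ r ih =>
    rw [← add_assoc, Function.iterate_succ_apply'] at hr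
    refine ih (h𝒟.mem_of_syzygy_mem hω hr fun W hW =>
      exists_extension_of_subsingleton_ext ?_)
    -- The required `Ext¹` sits in degree `t + r + 1` over `M`, beyond the injective dimension of
    -- `W`.
    rw [← subsingleton_ext_add_iff (t + r) M W.obj 0]
    have hWt : relId Set.univ W ≤ t :=
      (le_iSup₂_of_le (f := fun Y (_ : Y ∈ ω) => relId Set.univ Y) W hW le_rfl).trans ht
    exact subsingleton_ext_of_relId_le hWt (by omega) (Set.mem_univ M)

theorem PhiDim_le_idClass_add {𝒟 ω : Set (FGModuleCat.{u} Λ)} (h𝒟 : IsLeftSaturated 𝒟)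
    (hω : IsInjectiveRelativeCogenerator 𝒟 ω) {n : ℕ} (hn : syzygyClass Λ n ⊆ finResdim 𝒟) :
    PhiDim (Set.univ : Set (FGModuleCat.{u} Λ)) ≤ idClass ω + PhiDim 𝒟 + n := by
  rcases eq_or_ne (idClass ω) ⊤ with htop | htop
  · simp [htop]
  refine iSup₂_le fun X _ => ?_
  obtain ⟨t, ht⟩ := ENat.ne_top_iff_exists.1 htop
  rw [← ht]
  exact Phi_le_of_syzygy_iterate_mem
    (h𝒟.syzygy_iterate_mem_of_idClass_le hω ht.ge (hn ⟨X, rfl⟩))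

end IgusaTodorov

end

theorem theorem4 {R : Type w} {Λ : Type u} [CommRing R] [IsArtinianRing R] [Ring Λ]
    [Algebra R Λ] [Module.Finite R Λ] (n : ℕ) (𝒟 : Set (FGModuleCat.{u} Λ))
    (h𝒟 : IsLeftSaturated 𝒟) :
    haveI : IsArtinianRing Λ := IsArtinianRing.of_finite R Λ
    (finDim Λ ≤ PhiDim (Set.univ : Set (FGModuleCat.{u} Λ)) ∧
      PhiDim (Set.univ : Set (FGModuleCat.{u} Λ)) ≤
        resdimClass 𝒟 (syzygyClass Λ n) + PhiDim 𝒟 + n) ∧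
    ∀ ω : Set (FGModuleCat.{u} Λ), ClosedUnderSummands ω →
      IsInjectiveRelativeCogenerator 𝒟 ω → syzygyClass Λ n ⊆ finResdim 𝒟 →
      finDim Λ ≤ PhiDim (Set.univ : Set (FGModuleCat.{u} Λ)) ∧
      PhiDim (Set.univ : Set (FGModuleCat.{u} Λ)) ≤ idClass ω + PhiDim 𝒟 + n := by
  have : IsArtinianRing Λ := IsArtinianRing.of_finite R Λ
  exact ⟨⟨finDim_le_PhiDim Λ, PhiDim_le_resdimClass_add h𝒟 n⟩,
    fun ω _ hω hn => ⟨finDim_le_PhiDim Λ, PhiDim_le_idClass_add h𝒟 hω hn⟩⟩
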